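/- Let $\beta,\gamma>0$ with $\beta+2\gamma<1$. For $N\ge 1$ and $i,j\in[N]=\{1,\dots,N\}$ put $p_{i,j}=\frac{\beta N^{2\gamma-1}}{i^\gamma j^\gamma}\wedge 1$. Let $(G_N)_{N\ge1}$ be a sequence of random simple graphs, $G_N$ having vertex set $[N]$, such that for every $N$ there is a symmetric array $(q_{i,j})_{i,j\in[N]}$ (depending on $N$) of numbers in $(0,\tfrac12)$ for which each edge $\{i,j\}$, $i\ne j$, is present in $G_N$ independently of all others with probability $q_{i,j}$, and such that \[ \lim_{N\to\infty}\sum_{i\ne j}\frac{(p_{i,j}-q_{i,j})^2}{p_{i,j}}=0 . \] Let $\mathscr{C}(1)$ be the connected component of $G_N$ containing the vertex $1$, and let $\operatorname{d}(v)$ be the degree of $v$ in $G_N$. Then for every real $\eta\ge1$, \[ \sum_{v\in\mathscr{C}(1)}\operatorname{d}(v)^\eta=\Theta_{\mathbb P}^{\log N}\left(N^{\gamma\eta}\right), \] that is, there exist constants $K,K'>0$ such that, as $N\to\infty$, \[ \mathbb P\Big(\sum_{v\in\mathscr{C}(1)}\operatorname{d}(v)^\eta\le N^{\gamma\eta}(\log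 N)^{K}\Big)\to1 \quad\text{and}\quad \mathbb P\Big(N^{\gamma\eta}\le(\log N)^{K'}\sum_{v\in\mathscr{C}(1)}\operatorname{d}(v)^\eta\Big)\to1 . \] -/

import Mathlib

open MeasureTheory ProbabilityTheory Filter Topology

/-- The label in `[N] = {1, …, N}` of a vertex; the vertex set `[N]` is modelled by `Fin N`,
where `i : Fin N` stands for the vertex `i + 1`. -/
def vertexLabel {N : ℕ} (i : Fin N) : ℕ := (i : ℕ) + 1

/-- The Chung-Lu edge probabilities `p_{ij} = (β N^(2γ-1) / (i^γ j^γ)) ∧ 1`. -/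
noncomputable def chungLuProb (β γ : ℝ) (N : ℕ) (i j : Fin N) : ℝ :=
  min (β * (N : ℝ) ^ (2 * γ - 1) / ((vertexLabel i : ℝ) ^ γ * (vertexLabel j : ℝ) ^ γ)) 1

/-- `G` is a random simple graph on `[N]` in which the edges `{i, j}`, `i ≠ j`, are present
independently of each other, with probabilities `q i j`. The (measurable) edge events are indexed
by the pairs `i < j`, so that every unordered pair is listed once. -/
structure IsIndependentEdgeGraph {Ω : Type*} [MeasurableSpace Ω] (μ : Measure Ω) {N : ℕ}
    (q : Fin N → Fin N → ℝ) (G : Ω → SimpleGraph (Fin N)) : Prop where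
  measurableSet_adj : ∀ i j : Fin N, MeasurableSet {ω | (G ω).Adj i j}
  prob_adj : ∀ i j : Fin N, i ≠ j → μ.real {ω | (G ω).Adj i j} = q i j
  indep_adj : iIndepSet
    (fun e : {e : Fin N × Fin N // e.1 < e.2} => {ω | (G ω).Adj e.1.1 e.1.2}) μ

/-- The class `𝒢_{β,γ}` of inhomogeneous random graph models: a sequence of random simple graphs
`G N` on `[N]`, with `G N` defined on the probability space `(Ω N, μ N)`. -/
def InGraphClass (β γ : ℝ) {Ω : ℕ → Type*} [∀ N, MeasurableSpace (Ω N)]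
    (μ : ∀ N, Measure (Ω N)) (G : ∀ N, Ω N → SimpleGraph (Fin N)) : Prop :=
  ∃ q : ∀ N, Fin N → Fin N → ℝ,
    (∀ N i j, q N i j = q N j i) ∧
    (∀ N i j, i ≠ j → 0 < q N i j ∧ q N i j < 1 / 2) ∧
    (∀ N, IsIndependentEdgeGraph (μ N) (q N) (G N)) ∧
    Tendsto (fun N : ℕ => ∑ e ∈ (Finset.univ : Finset (Fin N)).offDiag,
      (chungLuProb β γ N e.1 e.2 - q N e.1 e.2) ^ 2 / chungLuProb β γ N e.1 e.2) atTop (𝓝 0)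

/-- The vertex set of `𝒞(k)`, the connected component of the vertex labelled `k`. -/
def componentOf {N : ℕ} (G : SimpleGraph (Fin N)) (k : ℕ) : Set (Fin N) :=
  {v | ∃ u : Fin N, vertexLabel u = k ∧ G.Reachable u v}

open scoped Classical in
/-- The sum of `d(v) ^ η` over the vertices `v` of the component `𝒞(k)`. -/
noncomputable def componentDegreeMoment {N : ℕ} (G : SimpleGraph (Fin N)) (k : ℕ) (η : ℝ) : ℝ :=
  ∑ v ∈ Finset.univ.filter (fun v => v ∈ componentOf G k), (G.degree v : ℝ) ^ η

/-- `X_N = O_ℙ^{log N}(Y_N)`: for some `K > 0`, `ℙ(X_N ≤ Y_N (log N)^K) → 1`. -/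
def IsBigOLogProb {Ω : ℕ → Type*} [∀ N, MeasurableSpace (Ω N)] (μ : ∀ N, Measure (Ω N))
    (X Y : ∀ N, Ω N → ℝ) : Prop :=
  ∃ K : ℝ, 0 < K ∧
    Tendsto (fun N : ℕ => (μ N).real {ω | X N ω ≤ Y N ω * Real.log (N : ℝ) ^ K}) atTop (𝓝 1)

/-- `X_N = Θ_ℙ^{log N}(Y_N)`: both `X_N = O_ℙ^{log N}(Y_N)` and `Y_N = O_ℙ^{log N}(X_N)`. -/
def IsThetaLogProb {Ω : ℕ → Type*} [∀ N, MeasurableSpace (Ω N)] (μ : ∀ N, Measure (Ω N))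
    (X Y : ∀ N, Ω N → ℝ) : Prop :=
  IsBigOLogProb μ X Y ∧ IsBigOLogProb μ Y X

/-!
Since `β < 1` and `2γ < 1`, the Chung-Lu probabilities are the rank-one kernel
`p i j = β N^(2γ-1) i^(-γ) j^(-γ)`.

**Upper bound.** For `η ≥ 1` the moment is at most the `η`-th power of the sum of the degrees over
the component, so it suffices to bound that sum by `N^γ log N`. It is at most twice the number of
self-avoiding walks of positive length from the vertex `1` (`sum_degree_reachable_le`). Fix `c > 1`.
An edge with `q > c p` contributes at least a constant multiple of `q` to the chi-square distance
`∑ (p - q)² / p` (`le_mul_sq_sub_div`), so with probability tending to one no such edge is present.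
The walks using only the remaining edges are compared with the kernel `c p`: by independence a walk
is present with the product of its edge probabilities, and for a rank-one kernel the expected number
of walks with `k + 1` steps is geometric in `k`, of ratio at most `c β / (1 - 2γ)`, with first term
`O(N^γ)` (`sum_pathWeight_rankOne`). As `β + 2γ < 1`, the constant `c` can be chosen so that the
ratio is below one, and Markov's inequality concludes
(`IsIndependentEdgeGraph.measureReal_sum_degree_ge`).

**Lower bound.** The vertex `1` has mean degree of order `N^γ`, because
`q ≥ (p - (p - q)² / p) / 2` (`half_sub_sq_sub_div_le`), and by Chebyshev's inequality its degree is
at least half its mean with probability tending to one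
(`IsIndependentEdgeGraph.measureReal_degree_le_half`).
-/

/-! ### Counting degrees by self-avoiding walks -/

open scoped Classical in
/-- Each adjacent pair `(v, w)` in the component of `u` with `w` at least as far from `u` as `v`
extends a geodesic from `u` to `v` to a self-avoiding walk from `u` ending in the step `v w`, so
distinct pairs give distinct walks; by symmetry these pairs make up at least half of all adjacent
pairs in the component. -/
theorem sum_degree_reachable_le {V : Type*} [Fintype V] (G : SimpleGraph V) (u : V) :
    ∑ v with G.Reachable u v, G.degree v ≤
      2 * ∑ k ∈ Finset.range (Fintype.card V), (Finset.univ.filter fun t : Fin (k + 1) → V =>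
        (u :: List.ofFn t).Nodup ∧ (u :: List.ofFn t).IsChain G.Adj).card := by
  set D : Finset (V × V) := Finset.univ.filter fun d => G.Reachable u d.1 ∧ G.Adj d.1 d.2 with hD
  set D' : Finset (V × V) := Finset.univ.filter fun d =>
    G.Reachable u d.1 ∧ G.Adj d.1 d.2 ∧ G.dist u d.1 ≤ G.dist u d.2 with hD'
  have hsum : ∑ v with G.Reachable u v, G.degree v = D.card := by
    have : D = (Finset.univ.filter fun v => G.Reachable u v).biUnion
        fun v => (G.neighborFinset v).image fun w => (v, w) := by
      ext ⟨a, b⟩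
      simp [hD]
    rw [this, Finset.card_biUnion]
    · refine Finset.sum_congr rfl fun v _ => ?_
      rw [Finset.card_image_of_injective _ (Prod.mk_right_injective v),
        SimpleGraph.card_neighborFinset_eq_degree]
    · intro x _ y _ hxy
      simp only [Function.onFun]
      rw [Finset.disjoint_left]
      rintro ⟨a, b⟩ h1 h2
      simp only [Finset.mem_image, Prod.mk.injEq] at h1 h2
      obtain ⟨_, _, rfl, _⟩ := h1
      obtain ⟨_, _, rfl, _⟩ := h2
      exact hxy rfl
  have hhalf : D.card ≤ 2 * D'.card := by
    have hsub : D ⊆ D' ∪ D'.image Prod.swap := by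
      rintro ⟨a, b⟩ h
      simp only [hD, hD', Finset.mem_filter, Finset.mem_univ, true_and, Finset.mem_union,
        Finset.mem_image] at h ⊢
      rcases le_total (G.dist u a) (G.dist u b) with hab | hab
      · exact Or.inl ⟨h.1, h.2, hab⟩
      · exact Or.inr ⟨(b, a), ⟨h.1.trans h.2.reachable, h.2.symm, hab⟩, rfl⟩
    calc D.card ≤ _ := Finset.card_le_card hsub
      _ ≤ D'.card + (D'.image Prod.swap).card := Finset.card_union_le _ _
      _ ≤ 2 * D'.card := by have := Finset.card_image_le (s := D') (f := Prod.swap); omega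
  have key : ∀ d ∈ D', ∃ l : List V, (u :: l).Nodup ∧ (u :: l).IsChain G.Adj ∧
      l.length < Fintype.card V + 1 ∧ l.length ≠ 0 ∧
        ∃ r, (u :: l).reverse = d.2 :: d.1 :: r := by
    rintro ⟨v, w⟩ h
    simp only [hD', Finset.mem_filter, Finset.mem_univ, true_and] at h
    obtain ⟨hr, hadj, hdist⟩ := h
    obtain ⟨p, hp, hlen⟩ := hr.exists_path_of_dist
    have hw : w ∉ p.support := by
      intro hmem
      have h1 := SimpleGraph.Walk.length_takeUntil_lt_length hmem hadj.ne'
      have h2 := SimpleGraph.dist_le (p.takeUntil w hmem)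
      omega
    have hq := hp.concat hw hadj
    have hcons : u :: (p.concat hadj).support.tail = (p.concat hadj).support :=
      SimpleGraph.Walk.cons_tail_support _
    refine ⟨(p.concat hadj).support.tail, ?_, ?_, ?_, ?_, p.reverse.support.tail, ?_⟩
    · rw [hcons]; exact hq.support_nodup
    · rw [hcons]; exact SimpleGraph.Walk.isChain_adj_support _
    · have := hq.length_lt
      simp only [List.length_tail, SimpleGraph.Walk.length_support]
      omega
    · simp
    · rw [hcons, SimpleGraph.Walk.support_concat, List.reverse_append, List.reverse_singleton,
        List.singleton_append, SimpleGraph.Walk.cons_tail_support, SimpleGraph.Walk.support_reverse]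
  choose! f hf using key
  have hcard : D'.card ≤ ∑ k ∈ Finset.range (Fintype.card V),
      (Finset.univ.filter fun t : Fin (k + 1) → V =>
        (u :: List.ofFn t).Nodup ∧ (u :: List.ofFn t).IsChain G.Adj).card := by
    calc D'.card ≤ ((Finset.range (Fintype.card V)).biUnion fun k =>
          (Finset.univ.filter fun t : Fin (k + 1) → V =>
            (u :: List.ofFn t).Nodup ∧ (u :: List.ofFn t).IsChain G.Adj).image List.ofFn).card := by
          refine Finset.card_le_card_of_injOn f ?_ ?_
          · intro d hd
            obtain ⟨h1, h2, h3, h4, -⟩ := hf d hd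
            obtain ⟨k, hk⟩ := Nat.exists_eq_succ_of_ne_zero h4
            simp only [Finset.coe_biUnion, Set.mem_iUnion, Finset.coe_image, Set.mem_image,
              Finset.mem_coe, Finset.mem_filter, Finset.mem_univ, true_and, Finset.mem_range]
            have hl : List.ofFn (fun i : Fin (k + 1) => (f d).get (i.cast hk.symm)) = f d := by
              refine List.ext_getElem (by simp [hk]) fun n _ _ => ?_
              rw [List.getElem_ofFn]
              rfl
            refine ⟨k, by omega, _, ?_, hl⟩
            rw [hl]
            exact ⟨h1, h2⟩
          · intro d hd d' hd' h
            obtain ⟨-, -, -, -, r, hr⟩ := hf d hd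
            obtain ⟨-, -, -, -, r', hr'⟩ := hf d' hd'
            rw [h, hr'] at hr
            simp only [List.cons.injEq] at hr
            exact Prod.ext hr.2.1.symm hr.1.symm
      _ ≤ _ := Finset.card_biUnion_le.trans
          (Finset.sum_le_sum fun k _ => Finset.card_image_le)
  rw [hsum]
  omega

/-! ### Path weights and rank-one kernels -/

/-- The product of the weights `c a b` over the consecutive pairs `(a, b)` of a list. -/
def pathWeight {V : Type*} (c : V → V → ℝ) : List V → ℝ
  | a :: b :: l => c a b * pathWeight c (b :: l)
  | _ => 1

theorem pathWeight_mono {V : Type*} {c c' : V → V → ℝ} (hc : ∀ a b, a ≠ b → 0 ≤ c a b) :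
    ∀ l : List V, l.Nodup → l.IsChain (fun a b => c a b ≤ c' a b) →
      0 ≤ pathWeight c l ∧ pathWeight c l ≤ pathWeight c' l
  | [], _, _ => by simp [pathWeight]
  | [a], _, _ => by simp [pathWeight]
  | a :: b :: l, hn, h => by
    have hab : a ≠ b := by
      rintro rfl
      simp at hn
    obtain ⟨h1, h2⟩ := List.isChain_cons_cons.1 h
    obtain ⟨h3, h4⟩ := pathWeight_mono hc (b :: l) hn.of_cons h2
    exact ⟨mul_nonneg (hc a b hab) h3,
      mul_le_mul h1 h4 h3 ((hc a b hab).trans h1)⟩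

theorem pathWeight_nonneg {V : Type*} {c : V → V → ℝ} (hc : ∀ a b, 0 ≤ c a b) :
    ∀ l : List V, 0 ≤ pathWeight c l
  | [] => zero_le_one
  | [_] => zero_le_one
  | a :: b :: l => mul_nonneg (hc a b) (pathWeight_nonneg hc (b :: l))

theorem sum_pathWeight_succ {V : Type*} [Fintype V] (c : V → V → ℝ) (u : V) (k : ℕ) :
    ∑ t : Fin (k + 1) → V, pathWeight c (u :: List.ofFn t) =
      ∑ v, c u v * ∑ t : Fin k → V, pathWeight c (v :: List.ofFn t) := by
  rw [← (Fin.consEquiv fun _ => V).sum_comp, Fintype.sum_prod_type]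
  refine Finset.sum_congr rfl fun v _ => ?_
  rw [Finset.mul_sum]
  refine Finset.sum_congr rfl fun t _ => ?_
  change pathWeight c (u :: List.ofFn (Fin.cons v t)) = _
  rw [List.ofFn_cons, pathWeight]

/-- For a rank-one kernel the total weight of the paths with `k + 1` steps is geometric in `k`. -/
theorem sum_pathWeight_rankOne {V : Type*} [Fintype V] (a : ℝ) (w : V → ℝ) (k : ℕ) (u : V) :
    ∑ t : Fin (k + 1) → V, pathWeight (fun i j => a * (w i * w j)) (u :: List.ofFn t) =
      a * (w u * ∑ v, w v) * (a * ∑ v, w v ^ 2) ^ k := by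
  induction k generalizing u with
  | zero =>
    rw [sum_pathWeight_succ]
    simp [pathWeight, Finset.mul_sum]
  | succ k ih =>
    rw [sum_pathWeight_succ]
    simp_rw [ih]
    calc _ = ∑ v, w v ^ 2 * (a * (w u * ∑ v, w v) * (a * ∑ v, w v ^ 2) ^ k * a) :=
          Finset.sum_congr rfl fun v _ => by ring
      _ = _ := by rw [← Finset.sum_mul]; ring

/-! ### Probability of a self-avoiding walk -/

/-- The steps of a self-avoiding walk are distinct edges, hence present independently. -/
theorem IsIndependentEdgeGraph.measureReal_isChain {Ω : Type*} [MeasurableSpace Ω] {μ : Measure Ω}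
    [IsProbabilityMeasure μ] {N : ℕ} {q : Fin N → Fin N → ℝ} {G : Ω → SimpleGraph (Fin N)}
    (h : IsIndependentEdgeGraph μ q G) (l : List (Fin N)) (hl : l.Nodup) :
    μ.real {ω | l.IsChain (G ω).Adj} = pathWeight q l := by
  classical
  have key : ∀ l : List (Fin N), l.Nodup →
      ∃ E : Finset {e : Fin N × Fin N // e.1 < e.2}, (∀ e ∈ E, e.1.1 ∈ l ∧ e.1.2 ∈ l) ∧
        {ω | l.IsChain (G ω).Adj} = ⋂ e ∈ E, {ω | (G ω).Adj e.1.1 e.1.2} ∧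
        ∏ e ∈ E, μ.real {ω | (G ω).Adj e.1.1 e.1.2} = pathWeight q l := by
    intro l
    induction l with
    | nil => exact fun _ => ⟨∅, by simp [pathWeight]⟩
    | cons a l ih =>
      intro hl
      cases l with
      | nil => exact ⟨∅, by simp [pathWeight]⟩
      | cons b l =>
        obtain ⟨E, hE, hset, hprod⟩ := ih hl.of_cons
        have ha : a ∉ b :: l := (List.nodup_cons.1 hl).1
        have hab : a ≠ b := by
          rintro rfl
          simp at ha
        obtain ⟨e, he, hadj⟩ : ∃ e : {e : Fin N × Fin N // e.1 < e.2},
            (e.1 = (a, b) ∨ e.1 = (b, a)) ∧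
              ∀ ω, (G ω).Adj e.1.1 e.1.2 ↔ (G ω).Adj a b := by
          rcases hab.lt_or_gt with hlt | hlt
          · exact ⟨⟨(a, b), hlt⟩, Or.inl rfl, fun _ => Iff.rfl⟩
          · exact ⟨⟨(b, a), hlt⟩, Or.inr rfl, fun ω => (G ω).adj_comm b a⟩
        have heE : e ∉ E := by
          intro hmem
          obtain ⟨h1, h2⟩ := hE e hmem
          rcases he with he | he <;> rw [he] at h1 h2
          · exact ha h1
          · exact ha h2
        refine ⟨insert e E, ?_, ?_, ?_⟩
        · intro e' he'
          rcases Finset.mem_insert.1 he' with rfl | he'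
          · rcases he with he | he <;> simp [he]
          · exact ⟨List.mem_cons_of_mem _ (hE e' he').1, List.mem_cons_of_mem _ (hE e' he').2⟩
        · rw [Finset.set_biInter_insert, ← hset]
          ext ω
          simp only [List.isChain_cons_cons, Set.mem_ofPred_eq, Set.mem_inter_iff, hadj]
        · rw [Finset.prod_insert heE, hprod, pathWeight]
          simp only [hadj]
          rw [h.prob_adj a b hab]
  obtain ⟨E, -, hset, hprod⟩ := key l hl
  rw [hset, measureReal_def, h.indep_adj.meas_biInter E, ENNReal.toReal_prod, ← hprod]
  rfl

/-! ### Concentration of a degree -/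

/-- Chebyshev's inequality for the number of independent events that occur: the variance is at
most the mean. -/
theorem measureReal_sum_indicator_le_half {Ω ι : Type*} [MeasurableSpace Ω] {μ : Measure Ω}
    [IsProbabilityMeasure μ] {A : ι → Set Ω} (hA : ∀ i, MeasurableSet (A i)) (hind : iIndepSet A μ)
    (s : Finset ι) (hm : 0 < ∑ i ∈ s, μ.real (A i)) :
    μ.real {ω | ∑ i ∈ s, (A i).indicator (fun _ => (1 : ℝ)) ω ≤ (∑ i ∈ s, μ.real (A i)) / 2} ≤
      4 / ∑ i ∈ s, μ.real (A i) := by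
  set m := ∑ i ∈ s, μ.real (A i) with hmdef
  set X : ι → Ω → ℝ := fun i => (A i).indicator fun _ => (1 : ℝ) with hX
  have hLp : ∀ i, MemLp (X i) 2 μ := fun i =>
    memLp_indicator_const 2 (hA i) 1 (Or.inr (measure_ne_top _ _))
  have hint : ∀ i, ∫ ω, X i ω ∂μ = μ.real (A i) := fun i => integral_indicator_one (hA i)
  have hvar : ∀ i, Var[X i; μ] ≤ μ.real (A i) := by
    intro i
    refine (variance_le_expectation_sq (hLp i).aestronglyMeasurable).trans_eq ?_
    rw [← hint i]
    congr 1
    ext ω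
    by_cases h : ω ∈ A i <;> simp [hX, h]
  have hmean : ∫ ω, (∑ i ∈ s, X i) ω ∂μ = m := by
    simp only [Finset.sum_apply]
    rw [integral_finsetSum s fun i _ => (hLp i).integrable one_le_two]
    exact Finset.sum_congr rfl fun i _ => hint i
  have hsum : Var[∑ i ∈ s, X i; μ] ≤ m := by
    rw [IndepFun.variance_sum (fun i _ => hLp i)
      fun i _ j _ hij => hind.iIndepFun_indicator.indepFun hij]
    exact Finset.sum_le_sum fun i _ => hvar i
  have hcheb := meas_ge_le_variance_div_sq (μ := μ) (memLp_finsetSum' s fun i _ => hLp i)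
    (half_pos hm)
  have hsub : {ω | ∑ i ∈ s, X i ω ≤ m / 2} ⊆
      {ω | m / 2 ≤ |(∑ i ∈ s, X i) ω - ∫ x, (∑ i ∈ s, X i) x ∂μ|} := by
    intro ω hω
    simp only [Set.mem_ofPred_eq] at hω ⊢
    rw [hmean, Finset.sum_apply]
    refine le_trans ?_ (neg_le_abs _)
    linarith
  calc μ.real {ω | ∑ i ∈ s, X i ω ≤ m / 2} ≤ Var[∑ i ∈ s, X i; μ] / (m / 2) ^ 2 := by
        refine ENNReal.toReal_le_of_le_ofReal (div_nonneg (variance_nonneg _ _) (sq_nonneg _)) ?_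
        exact (measure_mono hsub).trans hcheb
    _ ≤ m / (m / 2) ^ 2 := by gcongr
    _ = 4 / m := by field_simp; norm_num

open scoped Classical in
/-- Lower tail of the degree of the smallest vertex `u`; minimality ensures that the edges at `u` are
listed as the pairs `(u, v)`. -/
theorem IsIndependentEdgeGraph.measureReal_degree_le_half {Ω : Type*} [MeasurableSpace Ω]
    {μ : Measure Ω} [IsProbabilityMeasure μ] {N : ℕ} {q : Fin N → Fin N → ℝ}
    {G : Ω → SimpleGraph (Fin N)} (h : IsIndependentEdgeGraph μ q G) (u : Fin N)
    (hu : ∀ v, v ≠ u → u < v) (hm : 0 < ∑ v ∈ Finset.univ.erase u, q u v) :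
    μ.real {ω | ((G ω).degree u : ℝ) ≤ (∑ v ∈ Finset.univ.erase u, q u v) / 2} ≤
      4 / ∑ v ∈ Finset.univ.erase u, q u v := by
  set s : Finset {e : Fin N × Fin N // e.1 < e.2} :=
    (Finset.univ.erase u).attach.image fun v => ⟨(u, v.1), hu v.1 (Finset.ne_of_mem_erase v.2)⟩
    with hs
  have hsum : ∀ f : Fin N → Fin N → ℝ,
      ∑ e ∈ s, f e.1.1 e.1.2 = ∑ v ∈ Finset.univ.erase u, f u v := by
    intro f
    rw [hs, Finset.sum_image, Finset.sum_attach _ fun v => f u v]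
    intro v _ w _ hvw
    exact Subtype.ext (congrArg (fun e => e.1.2) hvw)
  have hq : ∑ e ∈ s, μ.real {ω | (G ω).Adj e.1.1 e.1.2} = ∑ v ∈ Finset.univ.erase u, q u v := by
    rw [← hsum]
    exact Finset.sum_congr rfl fun e _ => h.prob_adj _ _ e.2.ne
  have := measureReal_sum_indicator_le_half
    (fun e : {e : Fin N × Fin N // e.1 < e.2} => h.measurableSet_adj e.1.1 e.1.2) h.indep_adj s
    (by rw [hq]; exact hm)
  rw [hq] at this
  refine le_trans (measureReal_mono fun ω hω => ?_) this
  simp only [Set.mem_ofPred_eq] at hω ⊢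
  refine le_trans (le_of_eq ?_) hω
  rw [hsum fun a b => ({ω | (G ω).Adj a b} : Set Ω).indicator (fun _ => (1 : ℝ)) ω]
  have hset : (G ω).neighborFinset u =
      (Finset.univ.erase u).filter fun v => (G ω).Adj u v := by
    ext v
    simp only [SimpleGraph.mem_neighborFinset, Finset.mem_filter, Finset.mem_erase,
      Finset.mem_univ, and_true]
    exact ⟨fun hv => ⟨hv.ne', hv⟩, fun hv => hv.2⟩
  rw [← SimpleGraph.card_neighborFinset_eq_degree, hset, Finset.card_filter, Nat.cast_sum]
  refine Finset.sum_congr rfl fun v _ => ?_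
  simp [Set.indicator_apply]

/-! ### First-moment bound for the component -/

open scoped Classical in
/-- A first-moment bound against a rank-one kernel `a * (w i * w j)`. On the event that no edge
violating `q i j ≤ a * (w i * w j)` is present, every self-avoiding walk from `u` uses only edges
whose probability is dominated by the kernel, so that the expected number of these walks is at
most a geometric series. -/
theorem IsIndependentEdgeGraph.measureReal_sum_degree_ge {Ω : Type*} [MeasurableSpace Ω]
    {μ : Measure Ω} [IsProbabilityMeasure μ] {N : ℕ} {q : Fin N → Fin N → ℝ}
    {G : Ω → SimpleGraph (Fin N)} (h : IsIndependentEdgeGraph μ q G)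
    (hq : ∀ i j, i ≠ j → 0 ≤ q i j) {a : ℝ} (ha : 0 ≤ a) {w : Fin N → ℝ} (hw : ∀ i, 0 ≤ w i)
    {r : ℝ} (hr : a * ∑ i, w i ^ 2 ≤ r) (hr1 : r < 1) (u : Fin N) {T : ℝ} (hT : 0 < T) :
    μ.real {ω | T ≤ ((∑ v with (G ω).Reachable u v, (G ω).degree v : ℕ) : ℝ)} ≤
      (∑ e ∈ (Finset.univ : Finset (Fin N)).offDiag with ¬ q e.1 e.2 ≤ a * (w e.1 * w e.2),
        q e.1 e.2) + 2 * (a * (w u * ∑ i, w i) / (1 - r)) / T := by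
  set c : Fin N → Fin N → ℝ := fun i j => a * (w i * w j) with hc
  have hc0 : ∀ i j, 0 ≤ c i j := fun i j => mul_nonneg ha (mul_nonneg (hw i) (hw j))
  set s : (k : ℕ) → Finset (Fin (k + 1) → Fin N) := fun k => Finset.univ.filter fun t =>
    (u :: List.ofFn t).Nodup ∧ (u :: List.ofFn t).IsChain (fun i j => q i j ≤ c i j) with hs
  set A : (k : ℕ) → (Fin (k + 1) → Fin N) → Set Ω := fun k t =>
    {ω | (u :: List.ofFn t).IsChain (G ω).Adj} with hA
  have hAmeas : ∀ l : List (Fin N), MeasurableSet {ω | l.IsChain (G ω).Adj} := by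
    intro l
    induction l with
    | nil => simp
    | cons i l ih =>
      cases l with
      | nil => simp
      | cons j l =>
        simp only [List.isChain_cons_cons]
        exact (h.measurableSet_adj i j).inter ih
  set Z : Ω → ℝ := fun ω => ∑ k ∈ Finset.range N, ∑ t ∈ s k,
    (A k t).indicator (fun _ => (1 : ℝ)) ω with hZ
  have hint : ∀ k t, Integrable ((A k t).indicator (fun _ => (1 : ℝ))) μ := fun k t =>
    (integrable_const 1).indicator (hAmeas _)
  have hZint : Integrable Z μ :=
    integrable_finsetSum _ fun k _ => integrable_finsetSum _ fun t _ => hint k t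
  have hr0 : 0 ≤ a * ∑ i, w i ^ 2 := mul_nonneg ha (Finset.sum_nonneg fun i _ => sq_nonneg _)
  have hM0 : 0 ≤ a * (w u * ∑ i, w i) :=
    mul_nonneg ha (mul_nonneg (hw u) (Finset.sum_nonneg fun i _ => hw i))
  have hEZ : ∫ ω, Z ω ∂μ ≤ a * (w u * ∑ i, w i) / (1 - r) := by
    rw [hZ, integral_finsetSum _ fun k _ => integrable_finsetSum _ fun t _ => hint k t]
    calc ∑ k ∈ Finset.range N, ∫ ω, ∑ t ∈ s k, (A k t).indicator (fun _ => (1 : ℝ)) ω ∂μ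
        ≤ ∑ k ∈ Finset.range N, a * (w u * ∑ i, w i) * r ^ k := by
          refine Finset.sum_le_sum fun k _ => ?_
          rw [integral_finsetSum _ fun t _ => hint k t]
          calc ∑ t ∈ s k, ∫ ω, (A k t).indicator (fun _ => (1 : ℝ)) ω ∂μ
              ≤ ∑ t ∈ s k, pathWeight c (u :: List.ofFn t) := by
                refine Finset.sum_le_sum fun t ht => ?_
                obtain ⟨h1, h2⟩ := (Finset.mem_filter.1 ht).2
                refine (integral_indicator_one (hAmeas _)).trans_le ?_
                rw [h.measureReal_isChain _ h1]
                exact (pathWeight_mono hq _ h1 h2).2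
            _ ≤ ∑ t, pathWeight c (u :: List.ofFn t) :=
                Finset.sum_le_sum_of_subset_of_nonneg (Finset.subset_univ _)
                  fun t _ _ => pathWeight_nonneg hc0 _
            _ = a * (w u * ∑ i, w i) * (a * ∑ i, w i ^ 2) ^ k := sum_pathWeight_rankOne a w k u
            _ ≤ a * (w u * ∑ i, w i) * r ^ k := by gcongr
      _ = a * (w u * ∑ i, w i) * ∑ k ∈ Finset.range N, r ^ k := (Finset.mul_sum _ _ _).symm
      _ ≤ a * (w u * ∑ i, w i) * (1 - r)⁻¹ := by
          refine mul_le_mul_of_nonneg_left ?_ hM0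
          rw [← tsum_geometric_of_lt_one (hr0.trans hr) hr1]
          exact (summable_geometric_of_lt_one (hr0.trans hr) hr1).sum_le_tsum _
            fun i _ => pow_nonneg (hr0.trans hr) i
      _ = _ := (div_eq_mul_inv _ _).symm
  have hmarkov : μ.real {ω | T / 2 ≤ Z ω} ≤ 2 * (a * (w u * ∑ i, w i) / (1 - r)) / T := by
    have := mul_meas_ge_le_integral_of_nonneg (μ := μ) (f := Z)
      (Eventually.of_forall fun ω => Finset.sum_nonneg fun k _ => Finset.sum_nonneg fun t _ =>
        Set.indicator_nonneg (fun _ _ => zero_le_one) ω) hZint (T / 2)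
    rw [le_div_iff₀ hT]
    linarith
  have hsub : {ω | T ≤ ((∑ v with (G ω).Reachable u v, (G ω).degree v : ℕ) : ℝ)} ⊆
      (⋃ e ∈ (Finset.univ : Finset (Fin N)).offDiag.filter fun e => ¬ q e.1 e.2 ≤ c e.1 e.2,
        {ω | (G ω).Adj e.1 e.2}) ∪ {ω | T / 2 ≤ Z ω} := by
    intro ω hω
    by_cases hbad : ∃ i j, ¬ q i j ≤ c i j ∧ (G ω).Adj i j
    · obtain ⟨i, j, hij, hadj⟩ := hbad
      refine Or.inl (Set.mem_biUnion (x := (i, j)) ?_ hadj)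
      simpa [hadj.ne] using hij
    · right
      push Not at hbad
      simp only [Set.mem_ofPred_eq] at hω ⊢
      have hdet : ∑ v with (G ω).Reachable u v, (G ω).degree v ≤
          2 * ∑ k ∈ Finset.range N, (Finset.univ.filter fun t : Fin (k + 1) → Fin N =>
            (u :: List.ofFn t).Nodup ∧ (u :: List.ofFn t).IsChain (G ω).Adj).card := by
        have := sum_degree_reachable_le (G ω) u
        rw [Fintype.card_fin] at this
        convert this
      have hcount : ((∑ k ∈ Finset.range N, (Finset.univ.filter fun t : Fin (k + 1) → Fin N =>
          (u :: List.ofFn t).Nodup ∧ (u :: List.ofFn t).IsChain (G ω).Adj).card : ℕ) : ℝ) ≤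
            Z ω := by
        rw [hZ, Nat.cast_sum]
        refine Finset.sum_le_sum fun k _ => ?_
        rw [Finset.sum_indicator_eq_sum_filter, Finset.sum_const, nsmul_one]
        refine Nat.cast_le.2 (Finset.card_le_card fun t ht => ?_)
        simp only [Finset.mem_filter, Finset.mem_univ, true_and, hs, hA,
          Set.mem_ofPred_eq] at ht ⊢
        exact ⟨⟨ht.1, ht.2.imp fun i j hij => not_lt.1 fun hlt => hbad i j hlt hij⟩, ht.2⟩
      have := hω.trans ((Nat.cast_le (α := ℝ)).2 hdet)
      rw [Nat.cast_mul, Nat.cast_ofNat] at this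
      linarith
  refine (measureReal_mono hsub).trans ((measureReal_union_le _ _).trans ?_)
  refine add_le_add ((measureReal_biUnion_finset_le _ _).trans ?_) hmarkov
  refine Finset.sum_le_sum fun e he => ?_
  rw [h.prob_adj _ _ (Finset.mem_offDiag.1 (Finset.mem_filter.1 he).1).2.2]

/-! ### The Chung-Lu kernel -/

theorem vertexLabel_pos {N : ℕ} (i : Fin N) : (0 : ℝ) < vertexLabel i :=
  Nat.cast_pos.2 (Nat.succ_pos _)

/-- Comparison of `∑ i^(-a)` with the integral of `x^(-a)`; Bernoulli's inequality bounds each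
term by an increment of `x^(1-a) / (1-a)`. -/
theorem sum_vertexLabel_rpow_neg_le {a : ℝ} (ha : 0 ≤ a) (ha1 : a < 1) (N : ℕ) :
    ∑ i : Fin N, (vertexLabel i : ℝ) ^ (-a) ≤ (N : ℝ) ^ (1 - a) / (1 - a) := by
  have h1a : 0 < 1 - a := sub_pos.2 ha1
  induction N with
  | zero => simp [Real.zero_rpow h1a.ne']
  | succ N ih =>
    rw [Fin.sum_univ_castSucc]
    have hx : (0 : ℝ) < (N : ℝ) + 1 := by positivity
    have hstep : ((N : ℝ) + 1) ^ (-a) ≤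
        ((N : ℝ) + 1) ^ (1 - a) / (1 - a) - (N : ℝ) ^ (1 - a) / (1 - a) := by
      have hB := rpow_one_add_le_one_add_mul_self (s := -(1 / ((N : ℝ) + 1))) (p := 1 - a)
        (by rw [neg_le_neg_iff, div_le_one hx]; linarith [N.cast_nonneg (α := ℝ)]) h1a.le
        (by linarith)
      have hN : (N : ℝ) = ((N : ℝ) + 1) * (1 + -(1 / ((N : ℝ) + 1))) := by field_simp; ring
      have hNr : (N : ℝ) ^ (1 - a) =
          ((N : ℝ) + 1) ^ (1 - a) * (1 + -(1 / ((N : ℝ) + 1))) ^ (1 - a) := by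
        conv_lhs => rw [hN]
        refine Real.mul_rpow hx.le ?_
        have : 1 / ((N : ℝ) + 1) ≤ 1 := by
          rw [div_le_one hx]; linarith [N.cast_nonneg (α := ℝ)]
        linarith
      have hsplit : ((N : ℝ) + 1) ^ (1 - a) = ((N : ℝ) + 1) * ((N : ℝ) + 1) ^ (-a) := by
        rw [sub_eq_add_neg, Real.rpow_add hx, Real.rpow_one]
      rw [← sub_div, le_div_iff₀ h1a, hNr]
      have := mul_le_mul_of_nonneg_left hB (Real.rpow_nonneg hx.le (1 - a))
      have h2 : ((N : ℝ) + 1) ^ (1 - a) * (1 / ((N : ℝ) + 1)) = ((N : ℝ) + 1) ^ (-a) := by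
        rw [hsplit]; field_simp
      nlinarith
    have hlast : (vertexLabel (Fin.last N) : ℝ) = (N : ℝ) + 1 := by simp [vertexLabel]
    have hcast : ∀ i : Fin N, vertexLabel i.castSucc = vertexLabel i := fun i => rfl
    simp only [hcast, hlast]
    push_cast
    linarith

/-- Since `2γ < 1` and `β < 1`, the truncation in the Chung-Lu probabilities is never active, and
they form a rank-one kernel. -/
theorem chungLuProb_eq_mul {β γ : ℝ} (hβ : 0 < β) (hγ : 0 < γ) (hβγ : β + 2 * γ < 1) {N : ℕ}
    (i j : Fin N) : chungLuProb β γ N i j =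
      β * (N : ℝ) ^ (2 * γ - 1) * ((vertexLabel i : ℝ) ^ (-γ) * (vertexLabel j : ℝ) ^ (-γ)) := by
  have hN : (1 : ℝ) ≤ N := Nat.one_le_cast.2 (i.pos)
  have hl : ∀ k : Fin N, (vertexLabel k : ℝ) ^ (-γ) ≤ 1 := fun k =>
    Real.rpow_le_one_of_one_le_of_nonpos (Nat.one_le_cast.2 (Nat.succ_pos _)) (by linarith)
  have h0 : ∀ k : Fin N, 0 ≤ (vertexLabel k : ℝ) ^ (-γ) := fun k =>
    Real.rpow_nonneg (vertexLabel_pos k).le _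
  have hNp : (N : ℝ) ^ (2 * γ - 1) ≤ 1 :=
    Real.rpow_le_one_of_one_le_of_nonpos hN (by linarith)
  have hNp0 : 0 ≤ (N : ℝ) ^ (2 * γ - 1) := Real.rpow_nonneg (by linarith) _
  have heq : β * (N : ℝ) ^ (2 * γ - 1) / ((vertexLabel i : ℝ) ^ γ * (vertexLabel j : ℝ) ^ γ) =
      β * (N : ℝ) ^ (2 * γ - 1) * ((vertexLabel i : ℝ) ^ (-γ) * (vertexLabel j : ℝ) ^ (-γ)) := by
    rw [Real.rpow_neg (vertexLabel_pos i).le, Real.rpow_neg (vertexLabel_pos j).le, ← mul_inv,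
      div_eq_mul_inv]
  rw [chungLuProb, heq, min_eq_left]
  exact mul_le_one₀ (mul_le_one₀ (by linarith) hNp0 hNp) (mul_nonneg (h0 i) (h0 j))
    (mul_le_one₀ (hl i) (h0 j) (hl j))

theorem chungLuProb_pos {β γ : ℝ} (hβ : 0 < β) {N : ℕ} (i j : Fin N) :
    0 < chungLuProb β γ N i j := by
  have hN : (0 : ℝ) < N := Nat.cast_pos.2 i.pos
  have := vertexLabel_pos i
  have := vertexLabel_pos j
  exact lt_min (by positivity) one_pos

/-! ### Comparison of edge probabilities -/

/-- A probability exceeding its target by a factor `c > 1` is controlled by its contribution to the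
chi-square distance. -/
theorem le_mul_sq_sub_div {p q c : ℝ} (hp : 0 < p) (hc : 1 < c) (h : c * p < q) :
    q ≤ c / (c - 1) ^ 2 * ((p - q) ^ 2 / p) := by
  have hc1 : 0 < c - 1 := sub_pos.2 hc
  rw [div_mul_div_comm, le_div_iff₀ (by positivity)]
  -- The claim factors as `(q - c p) (c q - p) ≥ 0`.
  have hpq : p < q := (lt_mul_of_one_lt_left hp hc).trans h
  have hcq : 0 ≤ c * q - p := by nlinarith [mul_pos hc1 (hp.trans hpq)]
  nlinarith [mul_nonneg (sub_nonneg.2 h.le) hcq]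

theorem half_sub_sq_sub_div_le {p q : ℝ} (hp : 0 < p) :
    (p - (p - q) ^ 2 / p) / 2 ≤ q := by
  have h1 : (p - q) ^ 2 / p = p - 2 * q + q ^ 2 / p := by
    field_simp
    ring
  have h2 : 0 ≤ q ^ 2 / p := by positivity
  rw [h1]
  linarith

theorem sum_rpow_le_sum_rpow {ι : Type*} (s : Finset ι) (f : ι → ℝ) (hf : ∀ i ∈ s, 0 ≤ f i) {η : ℝ}
    (hη : 1 ≤ η) : ∑ i ∈ s, f i ^ η ≤ (∑ i ∈ s, f i) ^ η := by
  classical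
  induction s using Finset.induction_on with
  | empty => simp [Real.zero_rpow (by linarith : η ≠ 0)]
  | insert a s ha ih =>
    rw [Finset.sum_insert ha, Finset.sum_insert ha]
    have hs : ∀ i ∈ s, 0 ≤ f i := fun i hi => hf i (Finset.mem_insert_of_mem hi)
    exact (add_le_add_right (ih hs) _).trans
      (Real.add_rpow_le_rpow_add (hf a (Finset.mem_insert_self a s)) (Finset.sum_nonneg hs) hη)

/-! ### The component of the vertex `1` -/

theorem mem_componentOf_one {N : ℕ} (hN : 0 < N) {G : SimpleGraph (Fin N)} {v : Fin N} :
    v ∈ componentOf G 1 ↔ G.Reachable ⟨0, hN⟩ v := by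
  constructor
  · rintro ⟨u, hu, huv⟩
    obtain rfl : u = ⟨0, hN⟩ := Fin.ext (by simpa [vertexLabel] using hu)
    exact huv
  · exact fun h => ⟨⟨0, hN⟩, rfl, h⟩

open scoped Classical in
theorem componentDegreeMoment_one {N : ℕ} (hN : 0 < N) (G : SimpleGraph (Fin N)) (η : ℝ) :
    componentDegreeMoment G 1 η = ∑ v with G.Reachable ⟨0, hN⟩ v, (G.degree v : ℝ) ^ η := by
  rw [componentDegreeMoment]
  refine Finset.sum_congr ?_ fun v _ => by congr!
  ext v
  simp [mem_componentOf_one hN]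

/-- No measurability of `S N` is needed, by subadditivity of the outer measure. -/
theorem tendsto_measureReal_one_of_compl_le {Ω : ℕ → Type*} [∀ N, MeasurableSpace (Ω N)]
    (μ : ∀ N, Measure (Ω N)) [∀ N, IsProbabilityMeasure (μ N)] {S B : ∀ N, Set (Ω N)} {e : ℕ → ℝ}
    (hSB : ∀ᶠ N in atTop, (S N)ᶜ ⊆ B N ∧ (μ N).real (B N) ≤ e N) (he : Tendsto e atTop (𝓝 0)) :
    Tendsto (fun N => (μ N).real (S N)) atTop (𝓝 1) := by
  have h1 : Tendsto (fun N => 1 - e N) atTop (𝓝 1) := by simpa using he.const_sub 1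
  refine tendsto_of_tendsto_of_tendsto_of_le_of_le' h1 tendsto_const_nhds ?_
    (Eventually.of_forall fun N => measureReal_le_one)
  filter_upwards [hSB] with N hN
  have h2 : (1 : ℝ) ≤ (μ N).real (S N) + (μ N).real (S N)ᶜ := by
    rw [← probReal_univ (μ := μ N), ← Set.union_compl_self (S N)]
    exact measureReal_union_le _ _
  have h3 := measureReal_mono (μ := μ N) hN.1
  linarith [hN.2]

/-! ### Upper and lower bounds -/

/-- The ratio of the geometric series is `β N^(2γ-1) ∑ i^(-2γ) ≤ β / (1 - 2γ) < 1`, and it stays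
below one after the kernel is enlarged by a constant factor close to one. -/
theorem componentDegreeMoment_isBigOLogProb {β γ : ℝ} (hβ : 0 < β) (hγ : 0 < γ)
    (hβγ : β + 2 * γ < 1) {Ω : ℕ → Type*} [∀ N, MeasurableSpace (Ω N)]
    (μ : ∀ N, Measure (Ω N)) [∀ N, IsProbabilityMeasure (μ N)]
    (G : ∀ N, Ω N → SimpleGraph (Fin N)) (hG : InGraphClass β γ μ G) {η : ℝ} (hη : 1 ≤ η) :
    IsBigOLogProb μ (fun N ω => componentDegreeMoment (G N ω) 1 η)
      (fun N _ => (N : ℝ) ^ (γ * η)) := by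
  classical
  obtain ⟨q, -, hq, hind, hlim⟩ := hG
  have h2γ : 0 < 1 - 2 * γ := by linarith
  have h1γ : 0 < 1 - γ := by linarith
  set ρ : ℝ := β / (1 - 2 * γ) with hρ
  have hρ0 : 0 < ρ := div_pos hβ h2γ
  have hρ1 : ρ < 1 := (div_lt_one h2γ).2 (by linarith)
  -- The factor for which `c * ρ` is the midpoint of `ρ` and `1`.
  set c : ℝ := (1 + ρ) / (2 * ρ) with hc
  have hc1 : 1 < c := by rw [hc, one_lt_div (by positivity)]; linarith
  have hc0 : 0 < c := one_pos.trans hc1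
  have hcρ : c * ρ = (1 + ρ) / 2 := by rw [hc]; field_simp
  have hr1 : c * ρ < 1 := by rw [hcρ]; linarith
  set ε : ℕ → ℝ := fun N => ∑ e ∈ (Finset.univ : Finset (Fin N)).offDiag,
      (chungLuProb β γ N e.1 e.2 - q N e.1 e.2) ^ 2 / chungLuProb β γ N e.1 e.2 with hε
  set C : ℝ := 2 * (c * (β / (1 - γ)) / (1 - c * ρ)) with hC
  have herr : Tendsto (fun N : ℕ => c / (c - 1) ^ 2 * ε N + C / Real.log N) atTop (𝓝 0) := by
    have h1 := hlim.const_mul (c / (c - 1) ^ 2)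
    have h2 : Tendsto (fun N : ℕ => C / Real.log N) atTop (𝓝 0) :=
      tendsto_const_nhds.div_atTop (Real.tendsto_log_atTop.comp tendsto_natCast_atTop_atTop)
    simpa using h1.add h2
  refine ⟨η, by linarith, tendsto_measureReal_one_of_compl_le μ
    (B := fun N => {ω | (N : ℝ) ^ γ * Real.log N ≤
      ((∑ v with v ∈ componentOf (G N ω) 1, (G N ω).degree v : ℕ) : ℝ)}) ?_ herr⟩
  filter_upwards [eventually_ge_atTop 2] with N hN
  have hN0 : 0 < N := by omega
  have hNr : (0 : ℝ) < N := Nat.cast_pos.2 hN0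
  have hlog : 0 < Real.log N := Real.log_pos (by exact_mod_cast hN)
  have hT : 0 < (N : ℝ) ^ γ * Real.log N := by positivity
  simp only [mem_componentOf_one hN0]
  constructor
  · intro ω hω
    simp only [Set.mem_compl_iff, Set.mem_ofPred_eq, not_le] at hω ⊢
    by_contra! hlt
    refine absurd hω (not_lt.2 ?_)
    rw [componentDegreeMoment_one hN0]
    refine (sum_rpow_le_sum_rpow _ _ (fun v _ => Nat.cast_nonneg _) hη).trans ?_
    rw [Real.rpow_mul hNr.le, ← Real.mul_rpow (by positivity) hlog.le]
    refine Real.rpow_le_rpow (Finset.sum_nonneg fun v _ => Nat.cast_nonneg _) ?_ (by linarith)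
    rw [Nat.cast_sum] at hlt
    convert hlt.le
  · set w : Fin N → ℝ := fun i => (vertexLabel i : ℝ) ^ (-γ) with hw
    have hp : ∀ i j, chungLuProb β γ N i j = β * (N : ℝ) ^ (2 * γ - 1) * (w i * w j) :=
      chungLuProb_eq_mul hβ hγ hβγ
    have hw0 : w ⟨0, hN0⟩ = 1 := by simp [hw, vertexLabel]
    have hsq : c * (β * (N : ℝ) ^ (2 * γ - 1)) * ∑ i, w i ^ 2 ≤ c * ρ := by
      have h1 : ∑ i, w i ^ 2 ≤ (N : ℝ) ^ (1 - 2 * γ) / (1 - 2 * γ) := by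
        refine le_trans (le_of_eq ?_)
          (sum_vertexLabel_rpow_neg_le (by linarith : 0 ≤ 2 * γ) (by linarith) N)
        refine Finset.sum_congr rfl fun i _ => ?_
        rw [hw, ← Real.rpow_natCast, ← Real.rpow_mul (vertexLabel_pos i).le]
        congr 1
        push_cast
        ring
      calc c * (β * (N : ℝ) ^ (2 * γ - 1)) * ∑ i, w i ^ 2
          ≤ c * (β * (N : ℝ) ^ (2 * γ - 1)) * ((N : ℝ) ^ (1 - 2 * γ) / (1 - 2 * γ)) := by gcongr
        _ = c * ρ * ((N : ℝ) ^ (2 * γ - 1) * (N : ℝ) ^ (1 - 2 * γ)) := by rw [hρ]; ring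
        _ = c * ρ := by rw [← Real.rpow_add hNr]; simp
    have hsum : c * (β * (N : ℝ) ^ (2 * γ - 1)) * (w ⟨0, hN0⟩ * ∑ i, w i) ≤
        c * (β / (1 - γ)) * (N : ℝ) ^ γ := by
      rw [hw0, one_mul]
      calc c * (β * (N : ℝ) ^ (2 * γ - 1)) * ∑ i, w i
          ≤ c * (β * (N : ℝ) ^ (2 * γ - 1)) * ((N : ℝ) ^ (1 - γ) / (1 - γ)) := by
            gcongr
            exact sum_vertexLabel_rpow_neg_le hγ.le (by linarith) N
        _ = c * (β / (1 - γ)) * ((N : ℝ) ^ (2 * γ - 1) * (N : ℝ) ^ (1 - γ)) := by ring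
        _ = c * (β / (1 - γ)) * (N : ℝ) ^ γ := by
            rw [← Real.rpow_add hNr]
            ring_nf
    have hmain := (hind N).measureReal_sum_degree_ge (fun i j hij => (hq N i j hij).1.le)
      (a := c * (β * (N : ℝ) ^ (2 * γ - 1))) (by positivity) (w := w)
      (fun i => Real.rpow_nonneg (vertexLabel_pos i).le _) hsq hr1 ⟨0, hN0⟩ hT
    have hbad : ∑ e ∈ (Finset.univ : Finset (Fin N)).offDiag with
        ¬ q N e.1 e.2 ≤ c * (β * (N : ℝ) ^ (2 * γ - 1)) * (w e.1 * w e.2), q N e.1 e.2 ≤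
          c / (c - 1) ^ 2 * ε N := by
      rw [hε, Finset.mul_sum]
      calc _ ≤ ∑ e ∈ (Finset.univ : Finset (Fin N)).offDiag with
            ¬ q N e.1 e.2 ≤ c * (β * (N : ℝ) ^ (2 * γ - 1)) * (w e.1 * w e.2),
              c / (c - 1) ^ 2 * ((chungLuProb β γ N e.1 e.2 - q N e.1 e.2) ^ 2 /
                chungLuProb β γ N e.1 e.2) := by
            refine Finset.sum_le_sum fun e he => ?_
            refine le_mul_sq_sub_div (chungLuProb_pos hβ _ _) hc1 ?_
            rw [hp, ← mul_assoc]
            exact not_le.1 (Finset.mem_filter.1 he).2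
        _ ≤ _ := by
            refine Finset.sum_le_sum_of_subset_of_nonneg (Finset.filter_subset _ _) fun e _ _ => ?_
            have := chungLuProb_pos (γ := γ) hβ e.1 e.2
            positivity
    have hdiv : 2 * (c * (β * (N : ℝ) ^ (2 * γ - 1)) * (w ⟨0, hN0⟩ * ∑ i, w i) / (1 - c * ρ)) /
        ((N : ℝ) ^ γ * Real.log N) ≤ C / Real.log N := by
      have h1r : 0 < 1 - c * ρ := sub_pos.2 hr1
      calc _ ≤ 2 * (c * (β / (1 - γ)) * (N : ℝ) ^ γ / (1 - c * ρ)) /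
              ((N : ℝ) ^ γ * Real.log N) := by gcongr
        _ = C / Real.log N := by
            have := (Real.rpow_pos_of_pos hNr γ).ne'
            rw [hC]
            field_simp
    refine le_trans (le_of_eq ?_) (hmain.trans (add_le_add (le_trans (le_of_eq ?_) hbad) hdiv))
    · congr!
    · congr!

/-- The vertex `1` alone supplies the lower bound: its mean degree is of order `N^γ`, and its degree
concentrates. -/
theorem isBigOLogProb_componentDegreeMoment {β γ : ℝ} (hβ : 0 < β) (hγ : 0 < γ)
    (hβγ : β + 2 * γ < 1) {Ω : ℕ → Type*} [∀ N, MeasurableSpace (Ω N)]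
    (μ : ∀ N, Measure (Ω N)) [∀ N, IsProbabilityMeasure (μ N)]
    (G : ∀ N, Ω N → SimpleGraph (Fin N)) (hG : InGraphClass β γ μ G) {η : ℝ} (hη : 1 ≤ η) :
    IsBigOLogProb μ (fun N _ => (N : ℝ) ^ (γ * η))
      (fun N ω => componentDegreeMoment (G N ω) 1 η) := by
  classical
  obtain ⟨q, -, hq, hind, hlim⟩ := hG
  have hpow : Tendsto (fun N : ℕ => (N : ℝ) ^ γ) atTop atTop :=
    (tendsto_rpow_atTop hγ).comp tendsto_natCast_atTop_atTop
  have hlogt : Tendsto (fun N : ℕ => Real.log N) atTop atTop :=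
    Real.tendsto_log_atTop.comp tendsto_natCast_atTop_atTop
  have herr : Tendsto (fun N : ℕ => 4 / (β / 8 * (N : ℝ) ^ γ)) atTop (𝓝 0) :=
    tendsto_const_nhds.div_atTop (hpow.const_mul_atTop (by positivity))
  refine ⟨η, by linarith, tendsto_measureReal_one_of_compl_le μ
    (B := fun N => {ω | ∀ u : Fin N, vertexLabel u = 1 →
      ((G N ω).degree u : ℝ) ≤ (∑ v ∈ Finset.univ.erase u, q N u v) / 2}) ?_ herr⟩
  filter_upwards [eventually_ge_atTop 2, hlogt.eventually_ge_atTop (16 / β),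
    hlim.eventually_le_const (show 0 < β / 4 by positivity)] with N hN hlogN hεN
  have hN0 : 0 < N := by omega
  have hN2 : (2 : ℝ) ≤ N := by exact_mod_cast hN
  have hNr : (0 : ℝ) < N := by linarith
  have hlog : 0 < Real.log N := lt_of_lt_of_le (by positivity) hlogN
  have hNγ : 1 ≤ (N : ℝ) ^ γ := Real.one_le_rpow (by linarith) hγ.le
  set u : Fin N := ⟨0, hN0⟩ with hu
  set m : ℝ := ∑ v ∈ Finset.univ.erase u, q N u v with hm
  have hmean : β / 2 * (N : ℝ) ^ γ ≤ ∑ v ∈ Finset.univ.erase u, chungLuProb β γ N u v := by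
    calc β / 2 * (N : ℝ) ^ γ ≤ ((N : ℝ) - 1) * (β * (N : ℝ) ^ (γ - 1)) := by
          rw [Real.rpow_sub_one hNr.ne']
          have : β / 2 * (N : ℝ) ^ γ = N / 2 * (β * ((N : ℝ) ^ γ / N)) := by field_simp
          rw [this]
          gcongr
          linarith
      _ = ∑ v ∈ Finset.univ.erase u, β * (N : ℝ) ^ (γ - 1) := by
          rw [Finset.sum_const, Finset.card_erase_of_mem (Finset.mem_univ u), Finset.card_univ,
            Fintype.card_fin, nsmul_eq_mul, Nat.cast_sub (by omega), Nat.cast_one]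
      _ ≤ _ := by
          refine Finset.sum_le_sum fun v _ => ?_
          have hu1 : (vertexLabel u : ℝ) ^ (-γ) = 1 := by simp [hu, vertexLabel]
          rw [chungLuProb_eq_mul hβ hγ hβγ, hu1, one_mul, mul_assoc]
          have hv : (N : ℝ) ^ (-γ) ≤ (vertexLabel v : ℝ) ^ (-γ) :=
            Real.rpow_le_rpow_of_nonpos (vertexLabel_pos v)
              (Nat.cast_le.2 (Nat.succ_le_of_lt v.2)) (by linarith)
          have : (N : ℝ) ^ (γ - 1) = (N : ℝ) ^ (2 * γ - 1) * (N : ℝ) ^ (-γ) := by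
            rw [← Real.rpow_add hNr]
            ring_nf
          rw [this]
          gcongr
  have hrow : ∑ v ∈ Finset.univ.erase u,
      (chungLuProb β γ N u v - q N u v) ^ 2 / chungLuProb β γ N u v ≤ β / 4 := by
    refine le_trans ?_ hεN
    rw [← Finset.sum_image (s := Finset.univ.erase u) (g := fun v => (u, v))
      (f := fun e : Fin N × Fin N => (chungLuProb β γ N e.1 e.2 - q N e.1 e.2) ^ 2 /
        chungLuProb β γ N e.1 e.2) fun a _ b _ h => congrArg Prod.snd h]
    refine Finset.sum_le_sum_of_subset_of_nonneg ?_ fun e _ _ => ?_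
    · intro e he
      obtain ⟨v, hv, rfl⟩ := Finset.mem_image.1 he
      simpa using (Finset.ne_of_mem_erase hv).symm
    · have := chungLuProb_pos (γ := γ) hβ e.1 e.2
      positivity
  have hm8 : β / 8 * (N : ℝ) ^ γ ≤ m := by
    have h1 : ∑ v ∈ Finset.univ.erase u, (chungLuProb β γ N u v -
        (chungLuProb β γ N u v - q N u v) ^ 2 / chungLuProb β γ N u v) / 2 ≤ m :=
      Finset.sum_le_sum fun v _ => half_sub_sq_sub_div_le (chungLuProb_pos hβ u v)
    rw [← Finset.sum_div, Finset.sum_sub_distrib] at h1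
    nlinarith
  have hm0 : 0 < m := lt_of_lt_of_le (by positivity) hm8
  constructor
  · intro ω hω
    simp only [Set.mem_compl_iff, Set.mem_ofPred_eq, not_le] at hω ⊢
    intro u' hu'
    obtain rfl : u' = u := Fin.ext (by simpa [vertexLabel] using hu')
    by_contra! hlt
    refine absurd hω (not_lt.2 ?_)
    rw [componentDegreeMoment_one hN0]
    have hdeg : ((G N ω).degree u : ℝ) ^ η ≤
        ∑ v with (G N ω).Reachable u v, ((G N ω).degree v : ℝ) ^ η :=
      Finset.single_le_sum (f := fun v => ((G N ω).degree v : ℝ) ^ η)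
        (fun v _ => Real.rpow_nonneg (Nat.cast_nonneg _) _) (by simp)
    have hle : (N : ℝ) ^ γ ≤ ((G N ω).degree u : ℝ) * Real.log N := by
      calc (N : ℝ) ^ γ = β / 8 * (N : ℝ) ^ γ / 2 * (16 / β) := by field_simp; norm_num
        _ ≤ ((G N ω).degree u : ℝ) * Real.log N := by
          have : β / 8 * (N : ℝ) ^ γ / 2 ≤ (G N ω).degree u := by linarith
          gcongr
    calc (N : ℝ) ^ (γ * η) = ((N : ℝ) ^ γ) ^ η := Real.rpow_mul hNr.le _ _
      _ ≤ (((G N ω).degree u : ℝ) * Real.log N) ^ η :=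
          Real.rpow_le_rpow (by positivity) hle (by linarith)
      _ = ((G N ω).degree u : ℝ) ^ η * Real.log N ^ η :=
          Real.mul_rpow (Nat.cast_nonneg _) hlog.le
      _ ≤ _ := by
          refine mul_le_mul_of_nonneg_right (hdeg.trans (le_of_eq ?_)) (Real.rpow_nonneg hlog.le _)
          congr!
  · have hmain := (hind N).measureReal_degree_le_half u
      (fun v hv => Fin.lt_def.2 (Nat.pos_of_ne_zero fun h0 => hv (Fin.ext h0)))
      (by convert hm0)
    have hle : (μ N).real {ω | ((G N ω).degree u : ℝ) ≤ m / 2} ≤ 4 / m := by convert hmain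
    refine (measureReal_mono fun ω hω => ?_).trans
      (hle.trans (div_le_div_of_nonneg_left (by norm_num) (by positivity) hm8))
    exact hω u rfl

theorem mainTheorem11 (β γ : ℝ) (hβ : 0 < β) (hγ : 0 < γ) (hβγ : β + 2 * γ < 1)
    {Ω : ℕ → Type*} [∀ N, MeasurableSpace (Ω N)]
    (μ : ∀ N, Measure (Ω N)) [∀ N, IsProbabilityMeasure (μ N)]
    (G : ∀ N, Ω N → SimpleGraph (Fin N)) (hG : InGraphClass β γ μ G)
    (η : ℝ) (hη : 1 ≤ η) :
    IsThetaLogProb μ (fun N ω => componentDegreeMoment (G N ω) 1 η)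
      (fun N _ => (N : ℝ) ^ (γ * η)) :=
  ⟨componentDegreeMoment_isBigOLogProb hβ hγ hβγ μ G hG hη,
    isBigOLogProb_componentDegreeMoment hβ hγ hβγ μ G hG hη⟩
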